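/- Let $\mathbb X\subseteq\mathbb R$ be closed and unbounded above, with jump operators $\sigma(t)=\inf\{s\in\mathbb X:s>t\}$, $\rho(t)=\sup\{s\in\mathbb X:s<t\}$ (with $\rho(t)=t$ if $t=\min\mathbb X$) and graininess $\mu(t)=\sigma(t)-t$. Let $t_0\in\mathbb X$, write $[t_0,\infty)_{\mathbb X}=[t_0,\infty)\cap\mathbb X$, and assume that $\mathbb X$ is Sturmian: $\sigma(\rho(t))=\rho(\sigma(t))=t$ for $t\in[t_0,\infty)_{\mathbb X}$. For functions on $[t_0,\infty)_{\mathbb X}$ let $^\Delta$ be the delta derivative $f^\Delta(t)=\lim_{s\to t}\frac{f(\sigma(t))-f(s)}{\sigma(t)-s}$. Let $$A=\begin{pmatrix}A_1&0\\0&A_2\end{pmatrix}\ge 0,\qquad B=\begin{pmatrix}B_1&B_2\\B_3&B_4\end{pmatrix}$$ with rd-continuous blocks $[t_0,\infty)_{\mathbb X}\to\mathbb C^{n\times n}$ such that $I_n+\mu B_2$ and $I_n+\mu B_3$ are invertible on $[t_0,\infty)_{\mathbb X}$. Put $$J=\begin{pmatrix}0&-I_n\\I_n&0\end{pmatrix},\quad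 E_2=(I_n+\mu B_2)^{-1},\quad H=\begin{pmatrix}I_n&0\\-\mu E_2(\lambda A_1+B_1)&E_2\end{pmatrix}\quad(\lambda\in\mathbb C).$$ Let $\widehat Y=(\widehat\theta\,|\,\widehat\phi)=\begin{pmatrix}\theta_1&\phi_1\\ \theta_2^\rho&\phi_2^\rho\end{pmatrix}$ be the fundamental system (depending on $\lambda$) of $J\widehat Y^\Delta=(\lambda A+B)H\widehat Y$ on $[t_0,\infty)_{\mathbb X}$ with $\widehat Y(t_0)=J$, and let $\phi=H\widehat\phi$. For a square matrix $M$ put $\operatorname{Re}M=\tfrac12(M+M^*)$. Let $\mathscr U\in\mathbb C^{n\times n}$ be invertible, $\mathscr U_{2n}=\operatorname{diag}(\mathscr U,-\mathscr U^*)$, and $W(t,\lambda)=\operatorname{Re}[\mathscr U_{2n}(\lambda A(t)+B(t))]$. Let $\lambda_0\in\mathbb C$ be such that $(\lambda_0,\mathscr U_{2n})$ is an admissible pair, i.e. $W(t,\lambda_0)\ge0$ for all $t\in[t_0,\infty)_{\mathbb X}$, and let $\lambda\in\Lambda(\lambda_0,\mathscr U_{2n})$, i.e. for some $\delta>0$,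 $$\operatorname{Re}[(\lambda-\lambda_0)\mathscr U_{2n}A(t)]\ge\delta\,\mathscr U_{2n}A(t)\mathscr U_{2n}^*\qquad\text{for all }t\in[t_0,\infty)_{\mathbb X}.$$ Assume the definiteness condition: if $\zeta\in\mathbb C^n$ and $W(t,\lambda)\phi(t)\zeta=0$ for all $t\in[t_0,\infty)_{\mathbb X}$, then $\zeta=0$. Define, for $t\in[t_0,\infty)_{\mathbb X}$, $$D(t,\lambda)=\{l\in\mathbb C^{n\times n}:(\widehat\theta(t)+\widehat\phi(t)l)^*\,\mathscr U_{2n}J\,(\widehat\theta(t)+\widehat\phi(t)l)\le0\},$$ $$P=-\operatorname{Re}[\phi_1^*\mathscr U\phi_2^\rho],\qquad T=-\tfrac12[\theta_1^*\mathscr U\phi_2^\rho+(\theta_2^{\rho})^*\mathscr U^*\phi_1],\qquad \mathscr C=-P^{-1}T^*\ \text{ where } P>0.$$ Then: (i) $D(t,\lambda)\subseteq D(\tau,\lambda)$ for $t,\tau\in[t_0,\infty)_{\mathbb X}$ with $t>\tau$. Moreover, there is $t_1\in[t_0,\infty)_{\mathbb X}$ such that $P(t,\lambda)>0$ for all $t\in[t_1,\infty)_{\mathbb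 X}$, and for every such $t_1$, with $D(\infty,\lambda):=\bigcap_{t\in[t_1,\infty)_{\mathbb X}}D(t,\lambda)$: (ii) $D(t,\lambda)-\mathscr C(t,\lambda)\subseteq D(\tau,\lambda)-\mathscr C(\tau,\lambda)$ for $t,\tau\in[t_1,\infty)_{\mathbb X}$ with $t>\tau$; (iii) $D(t,\lambda)$ is compact and convex for $t\in[t_1,\infty)_{\mathbb X}$; (iv) $\mathscr C(\infty,\lambda):=\lim_{t\to\infty}\mathscr C(t,\lambda)$ exists (limit along $t\in\mathbb X$); (v) $\bigcap_{t\in[t_1,\infty)_{\mathbb X}}[D(t,\lambda)-\mathscr C(t,\lambda)]=D(\infty,\lambda)-\mathscr C(\infty,\lambda)$; (vi) $\mathscr C(\infty,\lambda)\in D(\infty,\lambda)$. -/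

import Mathlib

open Matrix Set Filter Topology
open scoped ComplexOrder

noncomputable section

/-- Forward jump operator `σ(t) = inf {s ∈ T : s > t}` of a time scale `T`
(with the convention `σ(t) = t` when there is no such `s`). -/
def forwardJump (T : Set ℝ) (t : ℝ) : ℝ :=
  open Classical in if (T ∩ Ioi t).Nonempty then sInf (T ∩ Ioi t) else t

/-- Backward jump operator `ρ(t) = sup {s ∈ T : s < t}` of a time scale `T`
(with the convention `ρ(t) = t` when there is no such `s`). -/
def backwardJump (T : Set ℝ) (t : ℝ) : ℝ :=
  open Classical in if (T ∩ Iio t).Nonempty then sSup (T ∩ Iio t) else t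

/-- Graininess `μ(t) = σ(t) - t`. -/
def graininess (T : Set ℝ) (t : ℝ) : ℝ := forwardJump T t - t

/-- `f` has delta derivative `f'` at `t`: the quotients `(f(σ(t)) - f(s)) / (σ(t) - s)` converge
to `f'` as `s → t` in `T`, `s ≠ σ(t)`. (If `t` is right-scattered, then `s = t` is allowed.) -/
def HasDeltaDeriv {E : Type*} [AddCommGroup E] [Module ℝ E] [TopologicalSpace E]
    (T : Set ℝ) (f : ℝ → E) (f' : E) (t : ℝ) : Prop :=
  Tendsto (fun s : ℝ => (forwardJump T t - s)⁻¹ • (f (forwardJump T t) - f s))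
    (𝓝[T \ {forwardJump T t}] t) (𝓝 f')

/-- `f` is rd-continuous on `T`: continuous at the right-dense points of `T`, with (finite)
left limits at the left-dense points of `T`. -/
def RdContinuousOn {E : Type*} [TopologicalSpace E] (T : Set ℝ) (f : ℝ → E) : Prop :=
  ∀ t ∈ T, (forwardJump T t = t → ContinuousWithinAt f T t) ∧
    (backwardJump T t = t → ∃ L : E, Tendsto f (𝓝[T ∩ Iio t] t) (𝓝 L))

/-- The real part `Re M = (M + M*) / 2` of a square complex matrix. -/
def matRe {m : Type*} (M : Matrix m m ℂ) : Matrix m m ℂ :=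
  (1 / 2 : ℂ) • (M + Mᴴ)

/-- The data of a complex Hamiltonian system `J ŷ^Δ = (λ A + B) y` on `[t₀, ∞) ∩ 𝕏`, where `𝕏` is
a Sturmian time scale, together with the standing assumptions on them. -/
structure HamiltonianSystem (n : ℕ) where
  /-- the time scale -/
  X : Set ℝ
  /-- the initial point -/
  t₀ : ℝ
  /-- the diagonal blocks of the weight function -/
  A₁ : ℝ → Matrix (Fin n) (Fin n) ℂ
  A₂ : ℝ → Matrix (Fin n) (Fin n) ℂ
  /-- the blocks of the coefficient function -/
  B₁ : ℝ → Matrix (Fin n) (Fin n) ℂ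
  B₂ : ℝ → Matrix (Fin n) (Fin n) ℂ
  B₃ : ℝ → Matrix (Fin n) (Fin n) ℂ
  B₄ : ℝ → Matrix (Fin n) (Fin n) ℂ
  isClosed : IsClosed X
  not_bddAbove : ¬ BddAbove X
  t₀_mem : t₀ ∈ X
  sturmian : ∀ t ∈ X, t₀ ≤ t →
    forwardJump X (backwardJump X t) = t ∧ backwardJump X (forwardJump X t) = t
  rd_A₁ : RdContinuousOn (X ∩ Ici t₀) A₁
  rd_A₂ : RdContinuousOn (X ∩ Ici t₀) A₂
  rd_B₁ : RdContinuousOn (X ∩ Ici t₀) B₁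
  rd_B₂ : RdContinuousOn (X ∩ Ici t₀) B₂
  rd_B₃ : RdContinuousOn (X ∩ Ici t₀) B₃
  rd_B₄ : RdContinuousOn (X ∩ Ici t₀) B₄
  weight_nonneg : ∀ t ∈ X, t₀ ≤ t → (fromBlocks (A₁ t) 0 0 (A₂ t)).PosSemidef
  isUnit_B₂ : ∀ t ∈ X, t₀ ≤ t → IsUnit (1 + (graininess X t : ℂ) • B₂ t)
  isUnit_B₃ : ∀ t ∈ X, t₀ ≤ t → IsUnit (1 + (graininess X t : ℂ) • B₃ t)

namespace HamiltonianSystem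

variable {n : ℕ}

/-- The half line `[t₀, ∞) ∩ 𝕏`. -/
def halfLine (S : HamiltonianSystem n) : Set ℝ := S.X ∩ Ici S.t₀

/-- The weight function `A = diag(A₁, A₂)`. -/
def A (S : HamiltonianSystem n) (t : ℝ) : Matrix (Fin n ⊕ Fin n) (Fin n ⊕ Fin n) ℂ :=
  fromBlocks (S.A₁ t) 0 0 (S.A₂ t)

/-- The coefficient function `B`. -/
def B (S : HamiltonianSystem n) (t : ℝ) : Matrix (Fin n ⊕ Fin n) (Fin n ⊕ Fin n) ℂ :=
  fromBlocks (S.B₁ t) (S.B₂ t) (S.B₃ t) (S.B₄ t)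

/-- `E₂ = (I + μ B₂)⁻¹`. -/
def E₂ (S : HamiltonianSystem n) (t : ℝ) : Matrix (Fin n) (Fin n) ℂ :=
  (1 + (graininess S.X t : ℂ) • S.B₂ t)⁻¹

/-- The matrix `H(t)` (depending on `λ`) that recovers `y = H ŷ` from `ŷ = (y₁, y₂ ∘ ρ)`. -/
def H (S : HamiltonianSystem n) (lam : ℂ) (t : ℝ) :
    Matrix (Fin n ⊕ Fin n) (Fin n ⊕ Fin n) ℂ :=
  fromBlocks 1 0
    (-((graininess S.X t : ℂ) • (S.E₂ t * (lam • S.A₁ t + S.B₁ t)))) (S.E₂ t)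

/-- `Ŷ = (θ̂ | φ̂)` is the fundamental system of `J Ŷ^Δ = (λ A + B) H Ŷ` on `[t₀, ∞) ∩ 𝕏` with
`Ŷ(t₀) = J`. (The columns are linearly independent since `J` is invertible.) -/
def IsFundamentalSystem (S : HamiltonianSystem n) (lam : ℂ)
    (Y : ℝ → Matrix (Fin n ⊕ Fin n) (Fin n ⊕ Fin n) ℂ) : Prop :=
  Y S.t₀ = Matrix.J (Fin n) ℂ ∧
  ∀ t ∈ S.halfLine, ∃ Y' : Matrix (Fin n ⊕ Fin n) (Fin n ⊕ Fin n) ℂ,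
    HasDeltaDeriv S.halfLine Y Y' t ∧
    Matrix.J (Fin n) ℂ * Y' = (lam • S.A t + S.B t) * S.H lam t * Y t

end HamiltonianSystem

/-- `𝒰₂ₙ = diag(𝒰, -𝒰*)`. -/
def rotationMatrix {n : ℕ} (U : Matrix (Fin n) (Fin n) ℂ) :
    Matrix (Fin n ⊕ Fin n) (Fin n ⊕ Fin n) ℂ :=
  fromBlocks U 0 0 (-Uᴴ)

namespace HamiltonianSystem

variable {n : ℕ}

/-- `W(t, λ) = Re [𝒰₂ₙ (λ A(t) + B(t))]`. -/
def W (S : HamiltonianSystem n) (U : Matrix (Fin n) (Fin n) ℂ) (lam : ℂ) (t : ℝ) :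
    Matrix (Fin n ⊕ Fin n) (Fin n ⊕ Fin n) ℂ :=
  matRe (rotationMatrix U * (lam • S.A t + S.B t))

/-- `(λ₀, 𝒰₂ₙ)` is an admissible pair: `𝒰` is invertible and `W(t, λ₀) ≥ 0` on
`[t₀, ∞) ∩ 𝕏`. -/
def IsAdmissiblePair (S : HamiltonianSystem n) (lam₀ : ℂ) (U : Matrix (Fin n) (Fin n) ℂ) :
    Prop :=
  IsUnit U ∧ ∀ t ∈ S.halfLine, (S.W U lam₀ t).PosSemidef

/-- The cone-shaped set `Λ(λ₀, 𝒰₂ₙ)` of all `λ` such that, for some `δ > 0`,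
`Re [(λ - λ₀) 𝒰₂ₙ A(t)] ≥ δ 𝒰₂ₙ A(t) 𝒰₂ₙ*` for all `t ∈ [t₀, ∞) ∩ 𝕏`. -/
def coneSet (S : HamiltonianSystem n) (lam₀ : ℂ) (U : Matrix (Fin n) (Fin n) ℂ) : Set ℂ :=
  {lam | ∃ δ : ℝ, 0 < δ ∧ ∀ t ∈ S.halfLine,
    (matRe ((lam - lam₀) • (rotationMatrix U * S.A t)) -
      (δ : ℂ) • (rotationMatrix U * S.A t * (rotationMatrix U)ᴴ)).PosSemidef}

/-- The definiteness condition at `λ`: with `φ = H φ̂`, if `W(t, λ) φ(t) ζ = 0` for all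
`t ∈ [t₀, ∞) ∩ 𝕏`, then `ζ = 0`. -/
def IsDefinite (S : HamiltonianSystem n) (U : Matrix (Fin n) (Fin n) ℂ) (lam : ℂ)
    (Y : ℝ → Matrix (Fin n ⊕ Fin n) (Fin n ⊕ Fin n) ℂ) : Prop :=
  ∀ ζ : Fin n → ℂ,
    (∀ t ∈ S.halfLine, (S.W U lam t * (S.H lam t * Y t).toCols₂) *ᵥ ζ = 0) → ζ = 0

end HamiltonianSystem

/-- The Weyl–Sims set `D(t)` of the `l` with `(θ̂ + φ̂ l)* 𝒰₂ₙ J (θ̂ + φ̂ l) ≤ 0` at `t`, where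
`Ŷ = (θ̂ | φ̂)`. -/
def weylSimsSet {n : ℕ} (U : Matrix (Fin n) (Fin n) ℂ)
    (Y : ℝ → Matrix (Fin n ⊕ Fin n) (Fin n ⊕ Fin n) ℂ) (t : ℝ) :
    Set (Matrix (Fin n) (Fin n) ℂ) :=
  {l | (-(((Y t).toCols₁ + (Y t).toCols₂ * l)ᴴ * (rotationMatrix U * Matrix.J (Fin n) ℂ) *
    ((Y t).toCols₁ + (Y t).toCols₂ * l))).PosSemidef}

/-- `P = -Re [φ₁* 𝒰 φ₂^ρ]`, where `φ̂ = (φ₁, φ₂^ρ)`. -/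
def weylP {n : ℕ} (U : Matrix (Fin n) (Fin n) ℂ)
    (Y : ℝ → Matrix (Fin n ⊕ Fin n) (Fin n ⊕ Fin n) ℂ) (t : ℝ) : Matrix (Fin n) (Fin n) ℂ :=
  -matRe ((Y t).toBlocks₁₂ᴴ * U * (Y t).toBlocks₂₂)

/-- `T = -(θ₁* 𝒰 φ₂^ρ + θ₂^ρ* 𝒰* φ₁) / 2`, where `θ̂ = (θ₁, θ₂^ρ)` and `φ̂ = (φ₁, φ₂^ρ)`. -/
def weylT {n : ℕ} (U : Matrix (Fin n) (Fin n) ℂ)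
    (Y : ℝ → Matrix (Fin n ⊕ Fin n) (Fin n ⊕ Fin n) ℂ) (t : ℝ) : Matrix (Fin n) (Fin n) ℂ :=
  -((1 / 2 : ℂ) • ((Y t).toBlocks₁₁ᴴ * U * (Y t).toBlocks₂₂ +
    (Y t).toBlocks₂₁ᴴ * Uᴴ * (Y t).toBlocks₁₂))

/-- The centre `𝒞(t) = -P(t)⁻¹ T(t)*` of the Weyl–Sims set (meaningful when `P(t)` is
invertible). -/
def weylCentre {n : ℕ} (U : Matrix (Fin n) (Fin n) ℂ)
    (Y : ℝ → Matrix (Fin n ⊕ Fin n) (Fin n ⊕ Fin n) ℂ) (t : ℝ) : Matrix (Fin n) (Fin n) ℂ :=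
  -((weylP U Y t)⁻¹ * (weylT U Y t)ᴴ)

/-- The recentred Weyl–Sims set `D(t) - 𝒞(t)`. -/
def recentredWeylSimsSet {n : ℕ} (U : Matrix (Fin n) (Fin n) ℂ)
    (Y : ℝ → Matrix (Fin n ⊕ Fin n) (Fin n ⊕ Fin n) ℂ) (t : ℝ) :
    Set (Matrix (Fin n) (Fin n) ℂ) :=
  (fun l => l - weylCentre U Y t) '' weylSimsSet U Y t

/-- The limit set `D(∞) = ⋂ D(t)` over `t ∈ [t₁, ∞) ∩ 𝕏`. -/
def HamiltonianSystem.limitWeylSimsSet {n : ℕ} (S : HamiltonianSystem n)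
    (U : Matrix (Fin n) (Fin n) ℂ) (Y : ℝ → Matrix (Fin n ⊕ Fin n) (Fin n ⊕ Fin n) ℂ)
    (t₁ : ℝ) : Set (Matrix (Fin n) (Fin n) ℂ) :=
  ⋂ t ∈ S.X ∩ Ici t₁, weylSimsSet U Y t

end

/-! Write `K = 𝒰₂ₙ J`, which is Hermitian and block antidiagonal. A Lagrange identity
(`hasDeltaDeriv_form`) gives `(Ŷ* K Ŷ)^Δ = 2 (H Ŷ)* W (H Ŷ)`, and the cone condition together with
admissibility makes `W ≥ 0`. Hence `Ŷ* K Ŷ` increases in the Loewner order. Compressing it by the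
columns `(1; l)` and `(0; 1)` shows that the form `q_t(l)` defining `D(t)` increases for each fixed
`l`, and so does `P`; this nests the sets `D(t)`.

If `P` were never positive definite, compactness of the unit sphere would give one unit vector `ζ`
with `ζ* P ζ ≤ 0` at all times. As `P(t₀) = 0`, this quantity would vanish identically, and so would
its derivative, contradicting definiteness.

Where `P > 0`, completing the square (`weylForm_eq_add`) gives `q_t(l) = q_t(𝒞) + 2 (l - 𝒞)* P (l -
𝒞)`, whence compactness and convexity. The minimum `q_t(𝒞(t))` increases and is at most `0`. So
`D(t) - 𝒞(t)`, described by `q_t(𝒞) + 2 m* P m ≤ 0`, shrinks, and the convergence of the bounded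
increasing minima makes `𝒞(t)` Cauchy. The limit statements follow because each `D(τ)` is closed. -/

noncomputable section

/-! ### Delta calculus: product rule and monotonicity -/

section TimeScale

variable {T : Set ℝ} {t : ℝ}

theorem forwardJump_le {s : ℝ} (hs : s ∈ T) (hts : t < s) : forwardJump T t ≤ s := by
  have hne : (T ∩ Ioi t).Nonempty := ⟨s, hs, hts⟩
  rw [forwardJump, if_pos hne]
  exact csInf_le ⟨t, fun x hx => le_of_lt hx.2⟩ ⟨hs, hts⟩

theorem le_forwardJump (T : Set ℝ) (t : ℝ) : t ≤ forwardJump T t := by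
  unfold forwardJump
  split_ifs with h
  · exact le_csInf h fun x hx => le_of_lt hx.2
  · exact le_rfl

theorem forwardJump_mem (hT : IsClosed T) (ht : t ∈ T) : forwardJump T t ∈ T := by
  unfold forwardJump
  split_ifs with h
  · exact hT.closure_subset_iff.2 inter_subset_left
      (csInf_mem_closure h ⟨t, fun x hx => le_of_lt hx.2⟩)
  · exact ht

theorem exists_mem_Ioo_of_forwardJump_eq (h : (T ∩ Ioi t).Nonempty) (hσ : forwardJump T t = t)
    {b : ℝ} (hb : t < b) : ∃ s ∈ T, t < s ∧ s < b := by
  rw [forwardJump, if_pos h] at hσ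
  obtain ⟨s, hs, hsb⟩ := exists_lt_of_csInf_lt h (hσ.trans_lt hb)
  exact ⟨s, hs.1, hs.2, hsb⟩

theorem forwardJump_inter_Ici {a : ℝ} (hat : a ≤ t) :
    forwardJump (T ∩ Ici a) t = forwardJump T t := by
  have : T ∩ Ici a ∩ Ioi t = T ∩ Ioi t := by
    ext x
    simp only [mem_inter_iff, mem_Ici, mem_Ioi]
    constructor
    · rintro ⟨⟨h1, -⟩, h2⟩
      exact ⟨h1, h2⟩
    · rintro ⟨h1, h2⟩
      exact ⟨⟨h1, hat.trans h2.le⟩, h2⟩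
  unfold forwardJump
  rw [this]

namespace HasDeltaDeriv

section General

variable {E : Type*} [AddCommGroup E] [Module ℝ E] [TopologicalSpace E] [IsTopologicalAddGroup E]
  [ContinuousSMul ℝ E] {f : ℝ → E} {f' : E}

theorem tendsto (h : HasDeltaDeriv T f f' t) :
    Tendsto f (𝓝[T \ {forwardJump T t}] t)
      (𝓝 (f (forwardJump T t) - (forwardJump T t - t) • f')) := by
  have h1 : Tendsto (fun s : ℝ => forwardJump T t - s) (𝓝[T \ {forwardJump T t}] t)
      (𝓝 (forwardJump T t - t)) :=
    ((continuous_const.sub continuous_id).tendsto t).mono_left nhdsWithin_le_nhds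
  refine (tendsto_const_nhds.sub (h1.smul h)).congr' ?_
  filter_upwards [self_mem_nhdsWithin] with s hs
  have hne : forwardJump T t - s ≠ 0 := sub_ne_zero.2 fun h => hs.2 h.symm
  rw [smul_smul, mul_inv_cancel₀ hne, one_smul, sub_sub_cancel]

theorem forwardJump_eq [T2Space E] (ht : t ∈ T) (h : HasDeltaDeriv T f f' t) :
    f (forwardJump T t) = f t + (forwardJump T t - t) • f' := by
  by_cases hσ : forwardJump T t = t
  · simp [hσ]
  -- The filter omits `σ(t)`, not `t`, so at a right-scattered point it contains `t` itself and the
  -- limit is attained there.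
  · have h1 : Tendsto f (pure t) (𝓝 (f (forwardJump T t) - (forwardJump T t - t) • f')) :=
      h.tendsto.mono_left (pure_le_nhdsWithin ⟨ht, fun h => hσ h.symm⟩)
    have h2 := tendsto_nhds_unique h1 (tendsto_pure_nhds f t)
    rw [← h2, sub_add_cancel]

theorem continuousWithinAt [T2Space E] (ht : t ∈ T) (h : HasDeltaDeriv T f f' t) :
    ContinuousWithinAt f T t := by
  have h1 : ContinuousWithinAt f (T \ {forwardJump T t}) t := by
    have := h.tendsto
    rwa [h.forwardJump_eq ht, add_sub_cancel_right] at this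
  by_cases hσ : forwardJump T t = t
  · rw [hσ] at h1
    exact continuousWithinAt_sdiff_self.1 h1
  · refine h1.mono_of_mem_nhdsWithin ?_
    exact inter_mem_nhdsWithin T (isOpen_compl_singleton.mem_nhds (Ne.symm hσ))

end General

theorem conjTranspose_mul_mul {m k : Type*} [Fintype m] [Finite k] (K : Matrix m m ℂ)
    {Z : ℝ → Matrix m k ℂ} {Z' : Matrix m k ℂ} (ht : t ∈ T) (h : HasDeltaDeriv T Z Z' t) :
    HasDeltaDeriv T (fun s => (Z s)ᴴ * K * Z s)
      (Z'ᴴ * K * Z (forwardJump T t) + (Z t)ᴴ * K * Z') t := by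
  have hc : Tendsto Z (𝓝[T \ {forwardJump T t}] t) (𝓝 (Z t)) :=
    (h.continuousWithinAt ht).mono sdiff_subset
  have c1 : Continuous fun M : Matrix m k ℂ => Mᴴ * K * Z (forwardJump T t) := by fun_prop
  have c2 : Continuous fun p : Matrix m k ℂ × Matrix m k ℂ => p.1ᴴ * K * p.2 := by fun_prop
  have h1 := (c1.tendsto Z').comp h
  have h2 := (c2.tendsto (Z t, Z')).comp (hc.prodMk_nhds h)
  refine (h1.add h2).congr fun s => ?_
  simp only [Function.comp_apply, conjTranspose_smul, conjTranspose_sub, star_trivial,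
    Matrix.smul_mul, Matrix.mul_smul, ← smul_add]
  congr 1
  rw [Matrix.sub_mul, Matrix.sub_mul, Matrix.mul_sub]
  abel

theorem map {E F : Type*} [AddCommGroup E] [Module ℝ E] [TopologicalSpace E]
    [AddCommGroup F] [Module ℝ F] [TopologicalSpace F] {f : ℝ → E} {f' : E}
    (h : HasDeltaDeriv T f f' t) (L : E →L[ℝ] F) :
    HasDeltaDeriv T (fun s => L (f s)) (L f') t := by
  refine ((L.continuous.tendsto f').comp h).congr fun s => ?_
  simp

/-- Induction along the time scale. With slack `ε`, take the last point `c` of `[a, b]` up to which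
`f` has not dropped faster than slope `-ε`. If `c < b`, the bound extends past `c`: to a nearby
point when `c` is right-dense, to `σ(c)` when it is right-scattered. -/
theorem monotoneOn {f f' : ℝ → ℝ} (hT : IsClosed T)
    (hf : ∀ t ∈ T, HasDeltaDeriv T f (f' t) t) (hf' : ∀ t ∈ T, 0 ≤ f' t) : MonotoneOn f T := by
  intro a ha b hb hab
  refine le_of_forall_pos_le_add fun δ hδ => ?_
  obtain ⟨ε, hε, hεδ⟩ : ∃ ε > 0, ε * (b - a) ≤ δ := by
    -- The `+ 1` keeps the denominator positive when `a = b`.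
    refine ⟨δ / (b - a + 1), div_pos hδ (by linarith), ?_⟩
    rw [div_mul_eq_mul_div, div_le_iff₀ (by linarith)]
    nlinarith
  set G : Set ℝ := {s ∈ T | s ∈ Icc a b ∧ f a ≤ f s + ε * (s - a)} with hG
  have haG : a ∈ G := ⟨ha, ⟨le_rfl, hab⟩, by simp⟩
  have hbdd : BddAbove G := ⟨b, fun s hs => hs.2.1.2⟩
  set c := sSup G with hc
  have hcl : c ∈ closure G := csSup_mem_closure ⟨a, haG⟩ hbdd
  have hcT : c ∈ T := hT.closure_subset_iff.2 (fun s hs => hs.1) hcl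
  have hcab : c ∈ Icc a b := isClosed_Icc.closure_subset_iff.2 (fun s hs => hs.2.1) hcl
  have hcG : f a ≤ f c + ε * (c - a) := by
    have hcont : ContinuousWithinAt (fun s => f s + ε * (s - a)) G c :=
      (((hf c hcT).continuousWithinAt hcT).mono (fun s hs => hs.1)).add
        (by fun_prop)
    have : (𝓝[G] c).NeBot := mem_closure_iff_nhdsWithin_neBot.1 hcl
    refine ge_of_tendsto hcont ?_
    filter_upwards [self_mem_nhdsWithin] with s hs using hs.2.2
  rcases hcab.2.eq_or_lt with h | hlt
  · rw [h] at hcG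
    linarith
  exfalso
  have hne : (T ∩ Ioi c).Nonempty := ⟨b, hb, hlt⟩
  rcases (le_forwardJump T c).eq_or_lt with hσ | hσ
  · have h1 : ∀ᶠ s in 𝓝[T \ {forwardJump T c}] c,
        -ε < (forwardJump T c - s)⁻¹ • (f (forwardJump T c) - f s) :=
      (hf c hcT).eventually_const_lt (by linarith [hf' c hcT])
    rw [← hσ] at h1
    obtain ⟨r, hr, hr'⟩ := Metric.mem_nhdsWithin_iff.1 h1
    obtain ⟨s, hsT, hcs, hsr⟩ := exists_mem_Ioo_of_forwardJump_eq hne hσ.symm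
      (b := min (c + r) b) (lt_min (by linarith) hlt)
    have hs := hr' ⟨by
      rw [Metric.mem_ball, Real.dist_eq, abs_lt]
      constructor <;> linarith [hsr.trans_le (min_le_left _ _)], hsT, hcs.ne'⟩
    have hs2 : -ε < (c - s)⁻¹ * (f c - f s) := hs
    have h3 : (c - s)⁻¹ * (f c - f s) * (s - c) = f s - f c := by
      have : c - s ≠ 0 := by linarith
      field_simp
      ring
    have h4 := mul_lt_mul_of_pos_right hs2 (sub_pos.2 hcs)
    rw [h3] at h4
    have : s ∈ G := ⟨hsT, ⟨hcab.1.trans hcs.le, (hsr.trans_le (min_le_right _ _)).le⟩,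
      by linarith⟩
    exact absurd (le_csSup hbdd this) (not_le.2 hcs)
  · have h1 := (hf c hcT).forwardJump_eq hcT
    rw [smul_eq_mul] at h1
    have h2 := mul_nonneg (sub_pos.2 hσ).le (hf' c hcT)
    have h3 := mul_nonneg hε.le (sub_pos.2 hσ).le
    have : forwardJump T c ∈ G := ⟨forwardJump_mem hT hcT,
      ⟨hcab.1.trans hσ.le, forwardJump_le hb hlt⟩, by linarith⟩
    exact absurd (le_csSup hbdd this) (not_le.2 hσ)

/-- Unboundedness is what makes the derivative unique: at an isolated maximum `σ(t) = t`, the filter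
is trivial, and every value is a derivative. -/
theorem eq_zero_of_eqOn_const {f : ℝ → ℝ} {f' c : ℝ} (hT : IsClosed T) (hT' : ¬ BddAbove T)
    (ht : t ∈ T) (hf : HasDeltaDeriv T f f' t) (hc : ∀ s ∈ T, f s = c) : f' = 0 := by
  have hne : (T ∩ Ioi t).Nonempty := by
    obtain ⟨s, hs, hts⟩ := not_bddAbove_iff.1 hT' t
    exact ⟨s, hs, hts⟩
  have : (𝓝[T \ {forwardJump T t}] t).NeBot := by
    rw [← mem_closure_iff_nhdsWithin_neBot]
    by_cases hσ : forwardJump T t = t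
    · rw [hσ, Metric.mem_closure_iff]
      intro ε hε
      obtain ⟨s, hs, hts, hsε⟩ := exists_mem_Ioo_of_forwardJump_eq hne hσ
        (b := t + ε) (by linarith)
      refine ⟨s, ⟨hs, hts.ne'⟩, ?_⟩
      rw [Real.dist_eq, abs_lt]
      constructor <;> linarith
    · exact subset_closure ⟨ht, fun h => hσ h.symm⟩
  refine tendsto_nhds_unique (hf.congr' ?_) tendsto_const_nhds
  filter_upwards [self_mem_nhdsWithin] with s hs
  rw [hc _ (forwardJump_mem hT ht), hc s hs.1, sub_self, smul_zero]

end HasDeltaDeriv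

end TimeScale

/-! ### The Lagrange identity -/

section Form

variable {n : ℕ}

theorem rotationMatrix_mul_J (U : Matrix (Fin n) (Fin n) ℂ) :
    rotationMatrix U * Matrix.J (Fin n) ℂ = fromBlocks 0 (-U) (-Uᴴ) 0 := by
  simp [rotationMatrix, Matrix.J, fromBlocks_multiply]

theorem isHermitian_rotationMatrix_mul_J (U : Matrix (Fin n) (Fin n) ℂ) :
    (rotationMatrix U * Matrix.J (Fin n) ℂ).IsHermitian := by
  simp [rotationMatrix_mul_J, IsHermitian, fromBlocks_conjTranspose]

namespace HamiltonianSystem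

variable (S : HamiltonianSystem n) {lam : ℂ}
  {Y : ℝ → Matrix (Fin n ⊕ Fin n) (Fin n ⊕ Fin n) ℂ} {t : ℝ}

theorem isClosed_halfLine : IsClosed S.halfLine := S.isClosed.inter isClosed_Ici

theorem not_bddAbove_halfLine : ¬ BddAbove S.halfLine := by
  rw [not_bddAbove_iff]
  intro b
  obtain ⟨x, hx, hbx⟩ := not_bddAbove_iff.1 S.not_bddAbove (max b S.t₀)
  exact ⟨x, ⟨hx, (le_max_right b S.t₀).trans hbx.le⟩, (le_max_left _ _).trans_lt hbx⟩

theorem graininess_eq (ht : t ∈ S.halfLine) :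
    forwardJump S.halfLine t - t = graininess S.X t := by
  rw [halfLine, forwardJump_inter_Ici ht.2, graininess]

/-- `H` undoes the shift `ρ`: it advances the second component by one step `μ Z'` and leaves the
first alone. The first block row of the system supplies the second component of `Z'`, and `E₂ = 1 -
μ B₂ E₂` makes the blocks match. -/
theorem H_mul_eq {k : Type*} (ht : t ∈ S.halfLine)
    {Z Z' : Matrix (Fin n ⊕ Fin n) k ℂ}
    (hZ : Matrix.J (Fin n) ℂ * Z' = (lam • S.A t + S.B t) * S.H lam t * Z) :
    S.H lam t * Z = Z + (graininess S.X t : ℂ) •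
      ((fromBlocks 0 0 0 1 : Matrix (Fin n ⊕ Fin n) (Fin n ⊕ Fin n) ℂ) * Z') := by
  set g : ℂ := (graininess S.X t : ℂ) with hg
  have hinv : (1 + g • S.B₂ t) * S.E₂ t = 1 :=
    mul_nonsing_inv _ ((Matrix.isUnit_iff_isUnit_det _).1 (S.isUnit_B₂ t ht.1 ht.2))
  have hE : S.E₂ t = 1 - g • (S.B₂ t * S.E₂ t) := by
    rw [eq_sub_iff_add_eq, ← hinv, Matrix.add_mul, Matrix.one_mul, Matrix.smul_mul]
  have hF : (fromBlocks 0 0 0 1 : Matrix (Fin n ⊕ Fin n) (Fin n ⊕ Fin n) ℂ) =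
      fromBlocks 0 0 (-1) 0 * Matrix.J (Fin n) ℂ := by
    simp [Matrix.J, fromBlocks_multiply]
  have hH : S.H lam t = 1 + g • (fromBlocks 0 0 (-1) 0 * ((lam • S.A t + S.B t) * S.H lam t)) := by
    rw [A, B, H, ← hg, ← fromBlocks_one, fromBlocks_smul, fromBlocks_add, fromBlocks_multiply,
      fromBlocks_multiply, fromBlocks_smul, fromBlocks_add]
    generalize lam • S.A₁ t + S.B₁ t = a
    congr 1
    · simp
    · simp
    · simp only [Matrix.zero_mul, zero_add, add_zero, smul_zero, Matrix.mul_one,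
        Matrix.neg_mul, Matrix.one_mul, Matrix.mul_neg, Matrix.mul_smul, ← Matrix.mul_assoc]
      conv_lhs => rw [hE]
      simp only [Matrix.sub_mul, Matrix.one_mul, Matrix.smul_mul, smul_sub, smul_add, smul_neg]
      abel
    · simpa [sub_eq_add_neg] using hE
  rw [hF, Matrix.mul_assoc, hZ]
  conv_lhs => rw [hH]
  rw [Matrix.add_mul, Matrix.one_mul, Matrix.smul_mul, Matrix.mul_assoc _ _ Z]

/-- Put `V = H Ŷ` and let `F` project onto the second component. Then `Ŷ = V - μ F Z'` and `Ŷ^σ = V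
+ μ (1 - F) Z'`. In the product rule the terms in `μ` cancel because `K (1 - F) = F K`, leaving `Z'*
K V + V* K Z'`, which the system turns into `2 V* W V`. -/
theorem hasDeltaDeriv_form {U : Matrix (Fin n) (Fin n) ℂ} (hY : S.IsFundamentalSystem lam Y)
    (ht : t ∈ S.halfLine) :
    HasDeltaDeriv S.halfLine
      (fun s => (Y s)ᴴ * (rotationMatrix U * Matrix.J (Fin n) ℂ) * Y s)
      ((2 : ℝ) • ((S.H lam t * Y t)ᴴ * S.W U lam t * (S.H lam t * Y t))) t := by
  obtain ⟨Z', hZ', hJ⟩ := hY.2 t ht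
  have hσ := hZ'.forwardJump_eq ht
  have hV := S.H_mul_eq ht hJ
  rw [Matrix.mul_assoc] at hJ
  have main := hZ'.conjTranspose_mul_mul (rotationMatrix U * Matrix.J (Fin n) ℂ) ht
  rw [S.graininess_eq ht] at hσ
  convert main using 1
  rw [hσ]
  generalize hVdef : S.H lam t * Y t = V at hV hJ
  set F : Matrix (Fin n ⊕ Fin n) (Fin n ⊕ Fin n) ℂ := fromBlocks 0 0 0 1 with hF
  have hZ : Y t = V - graininess S.X t •
      (F * Z') := by
    rw [hV, Complex.coe_smul, add_sub_cancel_right]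
  have hEF : rotationMatrix U * Matrix.J (Fin n) ℂ * F =
      fromBlocks 1 0 0 0 * (rotationMatrix U * Matrix.J (Fin n) ℂ) := by
    simp [hF, rotationMatrix_mul_J, fromBlocks_multiply]
  have hE1 : (fromBlocks 1 0 0 0 : Matrix (Fin n ⊕ Fin n) (Fin n ⊕ Fin n) ℂ) =
      1 - F := by
    rw [eq_sub_iff_add_eq, hF, fromBlocks_add]
    simp
  have hKZ : rotationMatrix U * Matrix.J (Fin n) ℂ * Z' =
      rotationMatrix U * (lam • S.A t + S.B t) * V := by
    rw [Matrix.mul_assoc, hJ, Matrix.mul_assoc]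
  have hZK : Z'ᴴ * (rotationMatrix U * Matrix.J (Fin n) ℂ) =
      Vᴴ * (rotationMatrix U * (lam • S.A t + S.B t))ᴴ := by
    rw [← conjTranspose_mul, ← hKZ, conjTranspose_mul, (isHermitian_rotationMatrix_mul_J U).eq]
  have hFh : Fᴴ =
      F := by simp [hF, fromBlocks_conjTranspose]
  have hcancel : Z'ᴴ * (rotationMatrix U * Matrix.J (Fin n) ℂ) * (Z' - F * Z') =
      Z'ᴴ * F * (rotationMatrix U * Matrix.J (Fin n) ℂ) * Z' := by
    rw [Matrix.mul_sub, ← Matrix.mul_assoc _ F, Matrix.mul_assoc Z'ᴴ _ F, hEF, hE1]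
    simp only [Matrix.mul_assoc, Matrix.sub_mul, Matrix.mul_sub, Matrix.one_mul]
    abel
  have e1 : Y t + graininess S.X t • Z' =
      V + graininess S.X t • (Z' - F * Z') := by
    rw [hZ, smul_sub]
    abel
  rw [e1, hZ, Matrix.mul_add, Matrix.mul_smul, hcancel, conjTranspose_sub, conjTranspose_smul,
    conjTranspose_mul, hFh, star_trivial, Matrix.sub_mul, Matrix.sub_mul, Matrix.smul_mul,
    Matrix.smul_mul, hZK, Matrix.mul_assoc Vᴴ (_ * _) Z', hKZ, W, matRe, Matrix.mul_smul,
    Matrix.smul_mul, Matrix.mul_add, Matrix.add_mul, ← Complex.coe_smul, smul_smul,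
    Matrix.mul_assoc Vᴴ _ V]
  norm_num
  abel

end HamiltonianSystem
end Form

open scoped MatrixOrder

/-! ### Loewner order through scalar quadratic forms -/

section QuadForm

variable {m k : Type*} [Fintype m]

/-- The real part of the sesquilinear form `x* M y` on the diagonal, linear in `M`. -/
def quadForm (x : m → ℂ) : Matrix m m ℂ →L[ℝ] ℝ where
  toFun M := (star x ⬝ᵥ M *ᵥ x).re
  map_add' M N := by simp [add_mulVec, dotProduct_add]
  map_smul' r M := by simp [smul_mulVec, dotProduct_smul]
  cont := by fun_prop

theorem quadForm_apply (x : m → ℂ) (M : Matrix m m ℂ) :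
    quadForm x M = (star x ⬝ᵥ M *ᵥ x).re := rfl

theorem quadForm_conjTranspose_mul_mul [Fintype k] (x : k → ℂ) (M : Matrix m m ℂ)
    (Z : Matrix m k ℂ) : quadForm x (Zᴴ * M * Z) = quadForm (Z *ᵥ x) M := by
  rw [quadForm_apply, quadForm_apply, star_mulVec, ← mulVec_mulVec, ← mulVec_mulVec,
    dotProduct_mulVec]

theorem continuous_quadForm_left (M : Matrix m m ℂ) : Continuous fun x => quadForm x M := by
  simp only [quadForm_apply]
  fun_prop

theorem quadForm_smul_left (c : ℝ) (x : m → ℂ) (M : Matrix m m ℂ) :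
    quadForm (c • x) M = c ^ 2 * quadForm x M := by
  simp only [quadForm_apply, mulVec_smul, star_smul, smul_dotProduct, dotProduct_smul,
    star_trivial, Complex.real_smul, Complex.re_ofReal_mul]
  ring

theorem posSemidef_iff_quadForm {M : Matrix m m ℂ} :
    M.PosSemidef ↔ M.IsHermitian ∧ ∀ x, 0 ≤ quadForm x M := by
  rw [posSemidef_iff_dotProduct_mulVec]
  refine and_congr_right fun hM => forall_congr' fun x => ?_
  rw [Complex.nonneg_iff, quadForm_apply]
  exact and_iff_left (hM.im_star_dotProduct_mulVec_self x).symm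

theorem posDef_iff_quadForm {M : Matrix m m ℂ} :
    M.PosDef ↔ M.IsHermitian ∧ ∀ x, x ≠ 0 → 0 < quadForm x M := by
  rw [posDef_iff_dotProduct_mulVec]
  refine and_congr_right fun hM => forall_congr' fun x => imp_congr_right fun _ => ?_
  rw [Complex.pos_iff, quadForm_apply]
  exact and_iff_left (hM.im_star_dotProduct_mulVec_self x).symm

theorem quadForm_mono {M N : Matrix m m ℂ} (h : M ≤ N) (x : m → ℂ) :
    quadForm x M ≤ quadForm x N := by
  have := (posSemidef_iff_quadForm.1 (Matrix.le_iff.1 h)).2 x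
  rwa [map_sub, sub_nonneg] at this

theorem isClosed_setOf_posSemidef : IsClosed {M : Matrix m m ℂ | M.PosSemidef} := by
  simp only [posSemidef_iff_quadForm, ofPred_and, ofPred_forall]
  refine IsClosed.inter ?_ (isClosed_iInter fun x => ?_)
  · exact isClosed_eq (by fun_prop) continuous_id
  · exact isClosed_le continuous_const (quadForm x).continuous

theorem Matrix.conjTranspose_mul_mul_mono [Finite k] {M N : Matrix m m ℂ} (h : M ≤ N)
    (Z : Matrix m k ℂ) : Zᴴ * M * Z ≤ Zᴴ * N * Z := by
  rw [Matrix.le_iff, ← Matrix.sub_mul, ← Matrix.mul_sub]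
  exact (Matrix.le_iff.1 h).conjTranspose_mul_mul_same Z

omit [Fintype m] in
theorem Matrix.PosDef.of_le {M N : Matrix m m ℂ} (hM : M.PosDef) (h : M ≤ N) : N.PosDef := by
  simpa using hM.add_posSemidef (Matrix.le_iff.1 h)

theorem Matrix.PosDef.exists_norm_le {M : Matrix m m ℂ} (hM : M.PosDef) :
    ∃ p > 0, ∀ x, p * ‖x‖ ^ 2 ≤ quadForm x M := by
  have hpos := (posDef_iff_quadForm.1 hM).2
  rcases (Metric.sphere (0 : m → ℂ) 1).eq_empty_or_nonempty with h | h
  -- The sphere is empty only when every vector is zero, and then any constant serves.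
  · refine ⟨1, one_pos, fun x => ?_⟩
    by_cases hx : x = 0
    · simp [hx, quadForm_apply]
    · exfalso
      have : ‖x‖⁻¹ • x ∈ Metric.sphere (0 : m → ℂ) 1 := by
        simp [norm_smul, hx]
      simp [h] at this
  · obtain ⟨y, hy, hmin⟩ := (isCompact_sphere (0 : m → ℂ) 1).exists_isMinOn h
      (continuous_quadForm_left M).continuousOn
    have hy0 : y ≠ 0 := by
      rintro rfl
      simp at hy
    refine ⟨quadForm y M, hpos y hy0, fun x => ?_⟩
    by_cases hx : x = 0
    · simp [hx, quadForm_apply]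
    · have hx' : ‖x‖ ≠ 0 := norm_ne_zero_iff.2 hx
      have hmem : ‖x‖⁻¹ • x ∈ Metric.sphere (0 : m → ℂ) 1 := by
        simp [norm_smul, hx]
      have h1 : quadForm y M ≤ quadForm (‖x‖⁻¹ • x) M := hmin hmem
      rw [quadForm_smul_left] at h1
      calc quadForm y M * ‖x‖ ^ 2 ≤ (‖x‖⁻¹ ^ 2 * quadForm x M) * ‖x‖ ^ 2 := by gcongr
        _ = quadForm x M := by field_simp

/-- `L e_j` is the `j`-th column, and each of its entries is bounded by its sup norm. -/
theorem norm_entry_sq_le [DecidableEq m] {p : ℝ} (hp : 0 < p) {M : Matrix m m ℂ}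
    (hM : ∀ x, p * ‖x‖ ^ 2 ≤ quadForm x M) (L : Matrix m m ℂ) (i j : m) :
    p * ‖L i j‖ ^ 2 ≤ quadForm (Pi.single j 1) (Lᴴ * M * L) := by
  rw [quadForm_conjTranspose_mul_mul]
  refine le_trans ?_ (hM _)
  have h := norm_le_pi_norm (L *ᵥ Pi.single j 1) i
  rw [mulVec_single_one] at h ⊢
  gcongr
  exact h

end QuadForm

/-! ### A Cauchy criterion from a decreasing potential -/

section Limits

theorem exists_tendsto_of_sq_norm_sub_le {X : Set ℝ} (hX : ¬ BddAbove X) {a : ℝ} {f : ℝ → ℂ}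
    {k : ℝ → ℝ} {p : ℝ} (hp : 0 < p) (hk : ∀ t ∈ X ∩ Ici a, 0 ≤ k t)
    (h : ∀ s ∈ X ∩ Ici a, ∀ t ∈ X ∩ Ici a, s ≤ t → p * ‖f t - f s‖ ^ 2 ≤ k s - k t) :
    ∃ z, Tendsto f (atTop ⊓ 𝓟 X) (𝓝 z) := by
  have hne : (atTop ⊓ 𝓟 X).NeBot := by
    rw [inf_principal_neBot_iff]
    intro U hU
    obtain ⟨b, hb⟩ := mem_atTop_sets.1 hU
    obtain ⟨x, hx, hbx⟩ := not_bddAbove_iff.1 hX b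
    exact ⟨x, hb x hbx.le, hx⟩
  rw [← cauchy_map_iff_exists_tendsto, Metric.cauchy_iff]
  refine ⟨hne.map f, fun ε hε => ?_⟩
  have hXa : (X ∩ Ici a).Nonempty := by
    obtain ⟨x, hx, hbx⟩ := not_bddAbove_iff.1 hX a
    exact ⟨x, hx, hbx.le⟩
  have hbdd : BddBelow (k '' (X ∩ Ici a)) := ⟨0, by rintro _ ⟨t, ht, rfl⟩; exact hk t ht⟩
  -- Once `k s` is within `p (ε / 2)²` of the infimum of `k`, no later value of `f` is as far as `ε
  -- / 2` from `f s`.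
  obtain ⟨_, ⟨s, hs, rfl⟩, hsκ⟩ := exists_lt_of_csInf_lt (hXa.image k)
    (lt_add_of_pos_right (sInf (k '' (X ∩ Ici a))) (show 0 < p * (ε / 2) ^ 2 by positivity))
  have key : ∀ t ∈ X ∩ Ici s, ‖f t - f s‖ < ε / 2 := by
    intro t ht
    have hta : t ∈ X ∩ Ici a := ⟨ht.1, (mem_Ici.1 hs.2).trans ht.2⟩
    have h1 := h s hs t hta ht.2
    have h2 : sInf (k '' (X ∩ Ici a)) ≤ k t := csInf_le hbdd ⟨t, hta, rfl⟩
    have h3 : p * ‖f t - f s‖ ^ 2 < p * (ε / 2) ^ 2 := by linarith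
    exact lt_of_pow_lt_pow_left₀ 2 (by positivity) (lt_of_mul_lt_mul_left h3 hp.le)
  refine ⟨f '' (X ∩ Ici s), image_mem_map ?_, ?_⟩
  · rw [inter_comm]
    exact inter_mem_inf (Ici_mem_atTop s) (mem_principal_self X)
  · rintro _ ⟨t, ht, rfl⟩ _ ⟨r, hr, rfl⟩
    calc dist (f t) (f r) ≤ dist (f t) (f s) + dist (f r) (f s) := dist_triangle_right _ _ _
      _ < ε / 2 + ε / 2 := by
        rw [dist_eq_norm, dist_eq_norm]
        exact add_lt_add (key t ht) (key r hr)
      _ = ε := add_halves ε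

end Limits

/-! ### Geometry of a single Weyl–Sims set -/

section WeylForm

variable {n : ℕ} {U : Matrix (Fin n) (Fin n) ℂ}
  {Y : ℝ → Matrix (Fin n ⊕ Fin n) (Fin n ⊕ Fin n) ℂ} {t : ℝ}

theorem toCols₁_add_toCols₂_mul (M : Matrix (Fin n ⊕ Fin n) (Fin n ⊕ Fin n) ℂ)
    (l : Matrix (Fin n) (Fin n) ℂ) : M.toCols₁ + M.toCols₂ * l =
      M * (fromRows 1 l : Matrix (Fin n ⊕ Fin n) (Fin n) ℂ) := by
  conv_rhs => rw [← fromCols_toCols M, fromCols_mul_fromRows, Matrix.mul_one]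

theorem toCols₂_eq_mul (M : Matrix (Fin n ⊕ Fin n) (Fin n ⊕ Fin n) ℂ) :
    M.toCols₂ = M * (fromRows 0 1 : Matrix (Fin n ⊕ Fin n) (Fin n) ℂ) := by
  conv_rhs => rw [← fromCols_toCols M, fromCols_mul_fromRows, Matrix.mul_one, Matrix.mul_zero,
    zero_add]

/-- The form `(θ̂ + φ̂ l)* 𝒰₂ₙ J (θ̂ + φ̂ l)` that defines the Weyl–Sims set. -/
def weylForm (U : Matrix (Fin n) (Fin n) ℂ)
    (Y : ℝ → Matrix (Fin n ⊕ Fin n) (Fin n ⊕ Fin n) ℂ) (t : ℝ) (l : Matrix (Fin n) (Fin n) ℂ) :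
    Matrix (Fin n) (Fin n) ℂ :=
  ((Y t).toCols₁ + (Y t).toCols₂ * l)ᴴ * (rotationMatrix U * Matrix.J (Fin n) ℂ) *
    ((Y t).toCols₁ + (Y t).toCols₂ * l)

theorem mem_weylSimsSet {l : Matrix (Fin n) (Fin n) ℂ} :
    l ∈ weylSimsSet U Y t ↔ weylForm U Y t l ≤ 0 := by
  rw [Matrix.le_iff, zero_sub]
  rfl

theorem mem_recentredWeylSimsSet {m : Matrix (Fin n) (Fin n) ℂ} :
    m ∈ recentredWeylSimsSet U Y t ↔ m + weylCentre U Y t ∈ weylSimsSet U Y t := by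
  constructor
  · rintro ⟨l, hl, rfl⟩
    simpa using hl
  · intro h
    exact ⟨_, h, add_sub_cancel_right _ _⟩

theorem continuous_weylForm : Continuous (weylForm U Y t) := by
  unfold weylForm
  fun_prop

theorem isClosed_weylSimsSet : IsClosed (weylSimsSet U Y t) :=
  isClosed_setOf_posSemidef.preimage continuous_weylForm.neg

theorem toCols₁_eq (M : Matrix (Fin n ⊕ Fin n) (Fin n ⊕ Fin n) ℂ) :
    M.toCols₁ = fromRows M.toBlocks₁₁ M.toBlocks₂₁ := by
  ext (i | i) j <;> rfl

theorem toCols₂_eq (M : Matrix (Fin n ⊕ Fin n) (Fin n ⊕ Fin n) ℂ) :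
    M.toCols₂ = fromRows M.toBlocks₁₂ M.toBlocks₂₂ := by
  ext (i | i) j <;> rfl

theorem toCols₂_form_eq_weylP :
    (Y t).toCols₂ᴴ * (rotationMatrix U * Matrix.J (Fin n) ℂ) * (Y t).toCols₂ =
      (2 : ℂ) • weylP U Y t := by
  rw [toCols₂_eq, rotationMatrix_mul_J, conjTranspose_fromRows_eq_fromCols_conjTranspose,
    fromCols_mul_fromBlocks, fromCols_mul_fromRows, weylP, matRe, smul_neg, smul_smul]
  simp [Matrix.mul_assoc]

theorem toCols₁_form_eq_weylT :
    (Y t).toCols₁ᴴ * (rotationMatrix U * Matrix.J (Fin n) ℂ) * (Y t).toCols₂ =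
      (2 : ℂ) • weylT U Y t := by
  rw [toCols₂_eq, toCols₁_eq, rotationMatrix_mul_J,
    conjTranspose_fromRows_eq_fromCols_conjTranspose,
    fromCols_mul_fromBlocks, fromCols_mul_fromRows, weylT, smul_neg, smul_smul]
  simp [Matrix.mul_assoc]

theorem toCols₂_form_eq_weylT :
    (Y t).toCols₂ᴴ * (rotationMatrix U * Matrix.J (Fin n) ℂ) * (Y t).toCols₁ =
      (2 : ℂ) • (weylT U Y t)ᴴ := by
  have h := congrArg conjTranspose (toCols₁_form_eq_weylT (U := U) (Y := Y) (t := t))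
  rw [conjTranspose_mul, conjTranspose_mul, conjTranspose_conjTranspose,
    (isHermitian_rotationMatrix_mul_J U).eq, conjTranspose_smul, ← Matrix.mul_assoc] at h
  simpa using h

theorem weylP_eq : weylP U Y t = (1 / 2 : ℝ) •
    ((Y t).toCols₂ᴴ * (rotationMatrix U * Matrix.J (Fin n) ℂ) * (Y t).toCols₂) := by
  rw [toCols₂_form_eq_weylP, ← Complex.coe_smul, smul_smul]
  norm_num

theorem isHermitian_weylP : (weylP U Y t).IsHermitian := by
  rw [IsHermitian, weylP_eq, conjTranspose_smul, star_trivial,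
    (isHermitian_conjTranspose_mul_mul _ (isHermitian_rotationMatrix_mul_J U)).eq]

/-- Completing the square: `P 𝒞 = -T*` is exactly the choice that absorbs the linear terms. -/
theorem weylForm_eq_add (hP : (weylP U Y t).PosDef) (l : Matrix (Fin n) (Fin n) ℂ) :
    weylForm U Y t l = weylForm U Y t (weylCentre U Y t) +
      (2 : ℝ) • ((l - weylCentre U Y t)ᴴ * weylP U Y t * (l - weylCentre U Y t)) := by
  have hdet := (Matrix.isUnit_iff_isUnit_det _).1 hP.isUnit
  have h1 : (weylT U Y t)ᴴ = -(weylP U Y t * weylCentre U Y t) := by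
    rw [weylCentre, Matrix.mul_neg, neg_neg, mul_nonsing_inv_cancel_left _ _ hdet]
  have h2 : weylT U Y t = -((weylCentre U Y t)ᴴ * weylP U Y t) := by
    have := congrArg conjTranspose h1
    rwa [conjTranspose_conjTranspose, conjTranspose_neg, conjTranspose_mul,
      isHermitian_weylP.eq] at this
  have h3 (l : Matrix (Fin n) (Fin n) ℂ) : weylForm U Y t l =
      (Y t).toCols₁ᴴ * (rotationMatrix U * Matrix.J (Fin n) ℂ) * (Y t).toCols₁ +
      (2 : ℂ) • (lᴴ * weylP U Y t * l - (weylCentre U Y t)ᴴ * weylP U Y t * l -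
        lᴴ * weylP U Y t * weylCentre U Y t) := by
    have e1 := toCols₂_form_eq_weylP (U := U) (Y := Y) (t := t)
    have e2 := toCols₁_form_eq_weylT (U := U) (Y := Y) (t := t)
    have e3 := toCols₂_form_eq_weylT (U := U) (Y := Y) (t := t)
    rw [h2] at e2
    rw [h1] at e3
    unfold weylForm
    generalize rotationMatrix U * Matrix.J (Fin n) ℂ = K at *
    calc _ = (Y t).toCols₁ᴴ * K * (Y t).toCols₁ + ((Y t).toCols₁ᴴ * K * (Y t).toCols₂) * l +
          lᴴ * ((Y t).toCols₂ᴴ * K * (Y t).toCols₁) +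
          lᴴ * ((Y t).toCols₂ᴴ * K * (Y t).toCols₂) * l := by
          simp only [conjTranspose_add, conjTranspose_mul, Matrix.add_mul, Matrix.mul_add,
            Matrix.mul_assoc]
          abel
      _ = _ := by
          rw [e1, e2, e3]
          simp only [Matrix.smul_mul, Matrix.mul_smul, Matrix.neg_mul, Matrix.mul_neg,
            Matrix.mul_assoc, smul_sub, smul_neg]
          abel
  rw [h3 l, h3 (weylCentre U Y t), ← Complex.coe_smul, add_assoc, Complex.ofReal_ofNat, ← smul_add]
  congr 2
  simp only [conjTranspose_sub, Matrix.sub_mul, Matrix.mul_sub]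
  abel

/-- For `E = (1, -U)` and `F = diag(1, U)` one has `K = E* E - F* F`, so `K` is nonpositive on the
kernel of `E`. -/
theorem quadForm_rotationMatrix_mul_J_nonpos {y : Fin n ⊕ Fin n → ℂ}
    (hy : fromCols 1 (-U) *ᵥ y = 0) :
    quadForm y (rotationMatrix U * Matrix.J (Fin n) ℂ) ≤ 0 := by
  set E : Matrix (Fin n) (Fin n ⊕ Fin n) ℂ := fromCols 1 (-U) with hE
  set F : Matrix (Fin n ⊕ Fin n) (Fin n ⊕ Fin n) ℂ := fromBlocks 1 0 0 U with hF
  have h1 : rotationMatrix U * Matrix.J (Fin n) ℂ ≤ Eᴴ * (1 : Matrix (Fin n) (Fin n) ℂ) * E := by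
    have : Eᴴ * (1 : Matrix (Fin n) (Fin n) ℂ) * E - rotationMatrix U * Matrix.J (Fin n) ℂ = Fᴴ * F := by
      rw [hE, hF, rotationMatrix_mul_J, Matrix.mul_one, conjTranspose_fromCols_eq_fromRows_conjTranspose,
        fromRows_mul_fromCols, fromBlocks_conjTranspose, fromBlocks_multiply, sub_eq_add_neg,
        fromBlocks_neg, fromBlocks_add]
      simp
    rw [Matrix.le_iff, this]
    exact posSemidef_conjTranspose_mul_self _
  refine (quadForm_mono h1 y).trans_eq ?_
  rw [quadForm_conjTranspose_mul_mul, hy]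
  simp [quadForm_apply]

/-- Since `𝒞` minimises the form, one `l` with nonpositive form suffices. It is found by solving `E
(θ̂ + φ̂ l) = 0`, which is possible because `E φ̂ v = 0` with `v ≠ 0` would force `v* P v ≤ 0`. -/
theorem weylForm_weylCentre_nonpos (hP : (weylP U Y t).PosDef) :
    weylForm U Y t (weylCentre U Y t) ≤ 0 := by
  set E : Matrix (Fin n) (Fin n ⊕ Fin n) ℂ := fromCols 1 (-U) with hE
  have hunit : IsUnit (E * (Y t).toCols₂) := by
    refine mulVec_injective_iff_isUnit.1
      ((injective_iff_map_eq_zero (E * (Y t).toCols₂).mulVecLin).2 fun v hv => ?_)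
    rw [mulVecLin_apply] at hv
    by_contra hv0
    have h1 := (posDef_iff_quadForm.1 hP).2 v hv0
    rw [← mulVec_mulVec] at hv
    have h2 := quadForm_rotationMatrix_mul_J_nonpos hv
    rw [← quadForm_conjTranspose_mul_mul, toCols₂_form_eq_weylP] at h2
    have h3 : quadForm v ((2 : ℝ) • weylP U Y t) ≤ 0 := by
      rwa [← Complex.coe_smul, Complex.ofReal_ofNat]
    rw [map_smul, smul_eq_mul] at h3
    linarith
  set l : Matrix (Fin n) (Fin n) ℂ := -((E * (Y t).toCols₂)⁻¹ * (E * (Y t).toCols₁)) with hl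
  have hEl : E * ((Y t).toCols₁ + (Y t).toCols₂ * l) = 0 := by
    rw [Matrix.mul_add, ← Matrix.mul_assoc, hl, Matrix.mul_neg,
      mul_nonsing_inv_cancel_left _ _ ((Matrix.isUnit_iff_isUnit_det _).1 hunit), add_neg_cancel]
  have h1 : weylForm U Y t l ≤ 0 := by
    rw [Matrix.le_iff, zero_sub, posSemidef_iff_quadForm]
    refine ⟨(isHermitian_conjTranspose_mul_mul _ (isHermitian_rotationMatrix_mul_J U)).neg,
      fun x => ?_⟩
    rw [map_neg, weylForm, quadForm_conjTranspose_mul_mul, neg_nonneg]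
    apply quadForm_rotationMatrix_mul_J_nonpos
    rw [mulVec_mulVec, ← hE, hEl, zero_mulVec]
  refine le_trans ?_ h1
  rw [weylForm_eq_add hP l, Matrix.le_iff, add_sub_cancel_left]
  exact (hP.posSemidef.conjTranspose_mul_mul_same _).smul zero_le_two

theorem isCompact_weylSimsSet (hP : (weylP U Y t).PosDef) : IsCompact (weylSimsSet U Y t) := by
  obtain ⟨p, hp, hpP⟩ := hP.exists_norm_le
  set C := weylCentre U Y t with hC
  -- The `(j, j)` entry of `q(l) ≤ 0` reads `2 p |l i j - C i j|² ≤ -q(C) j j` for every `i`.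
  set r : Fin n → ℝ := fun j => Real.sqrt (-quadForm (Pi.single j 1) (weylForm U Y t C) / (2 * p))
  have hK : IsCompact (Set.univ.pi fun i => Set.univ.pi fun j => Metric.closedBall (C i j) (r j)) :=
    isCompact_univ_pi fun i => isCompact_univ_pi fun j => isCompact_closedBall _ _
  refine hK.of_isClosed_subset isClosed_weylSimsSet
    fun (l : Matrix (Fin n) (Fin n) ℂ) hl i _ j _ => ?_
  replace hl := mem_weylSimsSet.1 hl
  rw [weylForm_eq_add hP, ← hC] at hl
  have h1 := quadForm_mono hl (Pi.single j 1)
  rw [map_add, map_smul, map_zero, smul_eq_mul] at h1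
  have h2 := norm_entry_sq_le hp hpP (l - C) i j
  rw [mem_closedBall_iff_norm]
  apply Real.le_sqrt_of_sq_le
  rw [le_div_iff₀ (by positivity)]
  rw [Matrix.sub_apply] at h2
  linarith

theorem convex_weylSimsSet (hP : (weylP U Y t).PosDef) : Convex ℝ (weylSimsSet U Y t) := by
  intro l hl m hm a b ha hb hab
  rw [mem_weylSimsSet] at *
  have hP0 := hP.posSemidef.conjTranspose_mul_mul_same (l - m)
  -- The convexity defect of a quadratic function; it is nonnegative because `P` is.
  have key : a • weylForm U Y t l + b • weylForm U Y t m - weylForm U Y t (a • l + b • m) =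
      (2 * (a * b)) • ((l - m)ᴴ * weylP U Y t * (l - m)) := by
    obtain rfl : a = 1 - b := by linarith
    rw [weylForm_eq_add hP l, weylForm_eq_add hP m, weylForm_eq_add hP (_ + _)]
    generalize weylForm U Y t (weylCentre U Y t) = F
    generalize weylCentre U Y t = C
    generalize weylP U Y t = P
    obtain ⟨x, rfl⟩ : ∃ x, l = C + x := ⟨l - C, by abel⟩
    obtain ⟨y, rfl⟩ : ∃ y, m = C + y := ⟨m - C, by abel⟩
    have e : (1 - b) • (C + x) + b • (C + y) - C = (1 - b) • x + b • y := by module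
    rw [e, add_sub_cancel_left, add_sub_cancel_left, add_sub_add_left_eq_sub]
    simp only [conjTranspose_sub, conjTranspose_add, conjTranspose_smul, star_trivial,
      Matrix.add_mul, Matrix.mul_add, Matrix.sub_mul, Matrix.mul_sub, Matrix.smul_mul,
      Matrix.mul_smul]
    module
  have h1 : weylForm U Y t (a • l + b • m) ≤ a • weylForm U Y t l + b • weylForm U Y t m := by
    rw [Matrix.le_iff, key]
    exact hP0.smul (by positivity)
  have h2 : ∀ {c : ℝ} {M : Matrix (Fin n) (Fin n) ℂ}, 0 ≤ c → M ≤ 0 → c • M ≤ 0 := by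
    intro c M hc hM
    rw [Matrix.le_iff, zero_sub] at *
    rw [← smul_neg]
    exact hM.smul hc
  exact h1.trans (add_nonpos (h2 ha hl) (h2 hb hm))

end WeylForm

/-! ### Monotonicity in time and convergence of the centres -/

namespace HamiltonianSystem

variable {n : ℕ} {S : HamiltonianSystem n} {U : Matrix (Fin n) (Fin n) ℂ} {lam lam₀ : ℂ}
  {Y : ℝ → Matrix (Fin n ⊕ Fin n) (Fin n ⊕ Fin n) ℂ} {s t : ℝ}

/-- `W(λ) = Re[(λ - λ₀) 𝒰₂ₙ A] + W(λ₀)`, and the first term dominates `δ 𝒰₂ₙ A 𝒰₂ₙ* ≥ 0`. -/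
theorem posSemidef_W (hadm : S.IsAdmissiblePair lam₀ U) (hlam : lam ∈ S.coneSet lam₀ U)
    (ht : t ∈ S.halfLine) : (S.W U lam t).PosSemidef := by
  obtain ⟨δ, hδ, hcone⟩ := hlam
  have h1 : (rotationMatrix U * S.A t * (rotationMatrix U)ᴴ).PosSemidef :=
    (S.weight_nonneg t ht.1 ht.2).mul_mul_conjTranspose_same _
  have h2 : ((δ : ℂ) • (rotationMatrix U * S.A t * (rotationMatrix U)ᴴ)).PosSemidef :=
    h1.smul (by exact_mod_cast hδ.le)
  have h3 := ((hcone t ht).add h2).add (hadm.2 t ht)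
  rw [sub_add_cancel] at h3
  convert h3 using 1
  rw [W, W, matRe, matRe, matRe, ← smul_add]
  congr 1
  rw [add_add_add_comm, ← conjTranspose_add]
  have : rotationMatrix U * (lam • S.A t + S.B t) =
      (lam - lam₀) • (rotationMatrix U * S.A t) + rotationMatrix U * (lam₀ • S.A t + S.B t) := by
    simp only [Matrix.mul_add, Matrix.mul_smul, sub_smul]
    abel
  rw [this]

theorem form_mono (hW : ∀ t ∈ S.halfLine, (S.W U lam t).PosSemidef)
    (hY : S.IsFundamentalSystem lam Y) (hs : s ∈ S.halfLine) (ht : t ∈ S.halfLine) (hst : s ≤ t) :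
    (Y s)ᴴ * (rotationMatrix U * Matrix.J (Fin n) ℂ) * Y s ≤
      (Y t)ᴴ * (rotationMatrix U * Matrix.J (Fin n) ℂ) * Y t := by
  have hH := fun r => isHermitian_conjTranspose_mul_mul (Y r) (isHermitian_rotationMatrix_mul_J U)
  rw [Matrix.le_iff, posSemidef_iff_quadForm]
  refine ⟨(hH t).sub (hH s), fun x => ?_⟩
  rw [map_sub, sub_nonneg]
  refine HasDeltaDeriv.monotoneOn S.isClosed_halfLine
    (fun r hr => (S.hasDeltaDeriv_form (U := U) hY hr).map (quadForm x)) (fun r hr => ?_) hs ht hst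
  rw [map_smul, quadForm_conjTranspose_mul_mul]
  exact mul_nonneg zero_le_two ((posSemidef_iff_quadForm.1 (hW r hr)).2 _)

theorem weylForm_mono (hW : ∀ t ∈ S.halfLine, (S.W U lam t).PosSemidef)
    (hY : S.IsFundamentalSystem lam Y) (hs : s ∈ S.halfLine) (ht : t ∈ S.halfLine) (hst : s ≤ t)
    (l : Matrix (Fin n) (Fin n) ℂ) : weylForm U Y s l ≤ weylForm U Y t l := by
  have := conjTranspose_mul_mul_mono (form_mono hW hY hs ht hst) (fromRows 1 l : Matrix _ (Fin n) ℂ)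
  simpa only [weylForm, toCols₁_add_toCols₂_mul, Matrix.conjTranspose_mul, Matrix.mul_assoc] using this

theorem weylP_mono (hW : ∀ t ∈ S.halfLine, (S.W U lam t).PosSemidef)
    (hY : S.IsFundamentalSystem lam Y) (hs : s ∈ S.halfLine) (ht : t ∈ S.halfLine)
    (hst : s ≤ t) : weylP U Y s ≤ weylP U Y t := by
  have := conjTranspose_mul_mul_mono (form_mono hW hY hs ht hst)
    (fromRows 0 1 : Matrix _ (Fin n) ℂ)
  rw [weylP_eq, weylP_eq, Matrix.le_iff, ← smul_sub]
  refine PosSemidef.smul ?_ (by norm_num)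
  rw [← Matrix.le_iff]
  simpa only [toCols₂_eq_mul, Matrix.conjTranspose_mul, Matrix.mul_assoc] using this

theorem exists_posDef_weylP (hW : ∀ t ∈ S.halfLine, (S.W U lam t).PosSemidef)
    (hY : S.IsFundamentalSystem lam Y) (hdef : S.IsDefinite U lam Y) :
    ∃ t₁ ∈ S.halfLine, (weylP U Y t₁).PosDef := by
  by_contra! hcon
  have ht₀ : S.t₀ ∈ S.halfLine := ⟨S.t₀_mem, self_mem_Ici⟩
  -- `Ŷ(t₀) = J` makes `φ₂^ρ` vanish at `t₀`.
  have hP0 : weylP U Y S.t₀ = 0 := by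
    simp [weylP, hY.1, Matrix.J, matRe]
  -- These compact sets decrease in `t` and are nonempty if `P` is never positive definite, so they
  -- share a unit vector.
  let Q : S.halfLine → Set (Fin n → ℂ) := fun t =>
    Metric.sphere 0 1 ∩ {ζ | quadForm ζ (weylP U Y t) ≤ 0}
  have hQclosed : ∀ t, IsClosed (Q t) := fun t => Metric.isClosed_sphere.inter
    (isClosed_le (continuous_quadForm_left _) continuous_const)
  have hne : Nonempty S.halfLine := ⟨⟨_, ht₀⟩⟩
  have hQ : (⋂ t, Q t).Nonempty := by
    refine IsCompact.nonempty_iInter_of_directed_nonempty_isCompact_isClosed Q ?_ ?_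
      (fun t => (isCompact_sphere _ _).of_isClosed_subset (hQclosed t) inter_subset_left) hQclosed
    · refine directed_of_isDirected_le fun s t hst => ?_
      rintro ζ ⟨h1, h2⟩
      exact ⟨h1, (quadForm_mono (weylP_mono hW hY s.2 t.2 hst) ζ).trans h2⟩
    · intro t
      have := hcon t t.2
      rw [posDef_iff_quadForm, not_and] at this
      have := this isHermitian_weylP
      push Not at this
      obtain ⟨x, hx, hxle⟩ := this
      refine ⟨‖x‖⁻¹ • x, by simp [norm_smul, hx], ?_⟩
      rw [mem_ofPred_eq, quadForm_smul_left]
      exact mul_nonpos_of_nonneg_of_nonpos (by positivity) hxle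
  obtain ⟨ζ, hζ⟩ := hQ
  rw [mem_iInter] at hζ
  have hzero : ∀ t ∈ S.halfLine, quadForm ζ (weylP U Y t) = 0 := by
    intro t ht
    refine le_antisymm (hζ ⟨t, ht⟩).2 ?_
    have := quadForm_mono (weylP_mono hW hY ht₀ ht ht.2) ζ
    rwa [hP0, map_zero] at this
  have hζ0 : ζ = 0 := by
    -- The constant function `ζ* P ζ` has derivative `(φ ζ)* W (φ ζ)`; its vanishing gives `W φ ζ =
    -- 0` because `W ≥ 0`.
    refine hdef ζ fun t ht => ?_
    have hd := (S.hasDeltaDeriv_form (U := U) hY ht).map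
      (quadForm ((fromRows 0 1 : Matrix _ (Fin n) ℂ) *ᵥ ζ))
    have h0 := hd.eq_zero_of_eqOn_const (c := 0) S.isClosed_halfLine S.not_bddAbove_halfLine ht
      (fun s hs => by
        have h1 := hzero s hs
        rw [weylP_eq, map_smul, smul_eq_mul, quadForm_conjTranspose_mul_mul, toCols₂_eq_mul,
          ← mulVec_mulVec, ← quadForm_conjTranspose_mul_mul] at h1
        linarith)
    rw [map_smul, smul_eq_mul, quadForm_conjTranspose_mul_mul, mulVec_mulVec,
      ← toCols₂_eq_mul] at h0
    have h1 : quadForm ((S.H lam t * Y t).toCols₂ *ᵥ ζ) (S.W U lam t) = 0 := by linarith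
    rw [← mulVec_mulVec, ← (hW t ht).dotProduct_mulVec_zero_iff]
    exact Complex.ext h1 ((hW t ht).isHermitian.im_star_dotProduct_mulVec_self _)
  have h1 := (hζ ⟨_, ht₀⟩).1
  simp [hζ0] at h1

/-- `q_s(𝒞(s)) ≤ q_s(𝒞(t)) ≤ q_t(𝒞(t))`: first minimality of the centre, then growth in time. -/
theorem weylForm_weylCentre_mono (hW : ∀ t ∈ S.halfLine, (S.W U lam t).PosSemidef)
    (hY : S.IsFundamentalSystem lam Y) (hs : s ∈ S.halfLine) (ht : t ∈ S.halfLine) (hst : s ≤ t)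
    (hP : (weylP U Y s).PosDef) :
    weylForm U Y s (weylCentre U Y s) ≤ weylForm U Y t (weylCentre U Y t) := by
  refine le_trans ?_ (weylForm_mono hW hY hs ht hst _)
  rw [weylForm_eq_add hP (weylCentre U Y t), Matrix.le_iff, add_sub_cancel_left]
  exact (hP.posSemidef.conjTranspose_mul_mul_same _).smul zero_le_two

theorem recentredWeylSimsSet_anti (hW : ∀ t ∈ S.halfLine, (S.W U lam t).PosSemidef)
    (hY : S.IsFundamentalSystem lam Y) (hs : s ∈ S.halfLine) (ht : t ∈ S.halfLine) (hst : s ≤ t)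
    (hP : (weylP U Y s).PosDef) :
    recentredWeylSimsSet U Y t ⊆ recentredWeylSimsSet U Y s := by
  intro m hm
  have hmono := weylP_mono hW hY hs ht hst
  rw [mem_recentredWeylSimsSet, mem_weylSimsSet] at *
  rw [weylForm_eq_add (hP.of_le hmono), add_sub_cancel_right] at hm
  rw [weylForm_eq_add hP, add_sub_cancel_right]
  refine (add_le_add (weylForm_weylCentre_mono hW hY hs ht hst hP) ?_).trans hm
  rw [Matrix.le_iff, ← smul_sub]
  exact (Matrix.le_iff.1 (conjTranspose_mul_mul_mono hmono m)).smul zero_le_two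

theorem exists_tendsto_weylCentre (hW : ∀ t ∈ S.halfLine, (S.W U lam t).PosSemidef)
    (hY : S.IsFundamentalSystem lam Y) {t₁ : ℝ} (ht₁ : t₁ ∈ S.halfLine)
    (hP : ∀ t ∈ S.X ∩ Ici t₁, (weylP U Y t).PosDef) :
    ∃ C, Tendsto (weylCentre U Y) (atTop ⊓ 𝓟 S.X) (𝓝 C) := by
  have hmem : ∀ t ∈ S.X ∩ Ici t₁, t ∈ S.halfLine := fun t ht => ⟨ht.1, (mem_Ici.1 ht₁.2).trans ht.2⟩
  obtain ⟨p, hp, hpP⟩ := (hP t₁ ⟨ht₁.1, self_mem_Ici⟩).exists_norm_le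
  have key : ∀ i j, ∃ z, Tendsto (fun t => weylCentre U Y t i j) (atTop ⊓ 𝓟 S.X) (𝓝 z) := by
    intro i j
    -- The potential `k` is minus the `j`-th diagonal entry of the minimal form. As `P` increases,
    -- the lower bound `p` at `t₁` stays valid, so `2 p |𝒞(t) - 𝒞(s)|² ≤ q_s(𝒞(t)) - q_s(𝒞(s)) ≤ k s
    -- - k t` for the entries concerned.
    refine exists_tendsto_of_sq_norm_sub_le (a := t₁) (p := 2 * p) S.not_bddAbove
      (k := fun t => -quadForm (Pi.single j 1) (weylForm U Y t (weylCentre U Y t)))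
      (by positivity) ?_ ?_
    · intro t ht
      have := quadForm_mono (weylForm_weylCentre_nonpos (hP t ht)) (Pi.single j 1)
      rw [map_zero] at this
      exact neg_nonneg.2 this
    · intro s hs t ht hst
      have h1 := quadForm_mono (weylForm_mono hW hY (hmem s hs) (hmem t ht) hst
        (weylCentre U Y t)) (Pi.single j 1)
      rw [weylForm_eq_add (hP s hs), map_add, map_smul, smul_eq_mul] at h1
      have h2 := norm_entry_sq_le hp (fun x => (hpP x).trans
        (quadForm_mono (weylP_mono hW hY ht₁ (hmem s hs) hs.2) x))
        (weylCentre U Y t - weylCentre U Y s) i j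
      rw [Matrix.sub_apply] at h2
      linarith
  choose z hz using key
  exact ⟨Matrix.of z, tendsto_pi_nhds.2 fun i => tendsto_pi_nhds.2 fun j => hz i j⟩

end HamiltonianSystem

/-! ### Assembly of the limit statements -/

open HamiltonianSystem in
theorem mainTheorem4 {n : ℕ} (S : HamiltonianSystem n)
    (lam₀ : ℂ) (U : Matrix (Fin n) (Fin n) ℂ) (hadm : S.IsAdmissiblePair lam₀ U)
    (lam : ℂ) (hlam : lam ∈ S.coneSet lam₀ U)
    (Y : ℝ → Matrix (Fin n ⊕ Fin n) (Fin n ⊕ Fin n) ℂ) (hY : S.IsFundamentalSystem lam Y)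
    (hdef : S.IsDefinite U lam Y) :
    (∀ t ∈ S.halfLine, ∀ τ ∈ S.halfLine, τ < t → weylSimsSet U Y t ⊆ weylSimsSet U Y τ) ∧
    (∃ t₁ ∈ S.halfLine, ∀ t ∈ S.X ∩ Ici t₁, (weylP U Y t).PosDef) ∧
    (∀ t₁ ∈ S.halfLine, (∀ t ∈ S.X ∩ Ici t₁, (weylP U Y t).PosDef) →
      (∀ t ∈ S.X ∩ Ici t₁, ∀ τ ∈ S.X ∩ Ici t₁, τ < t →
        recentredWeylSimsSet U Y t ⊆ recentredWeylSimsSet U Y τ) ∧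
      (∀ t ∈ S.X ∩ Ici t₁,
        IsCompact (weylSimsSet U Y t) ∧ Convex ℝ (weylSimsSet U Y t)) ∧
      ∃ Cinf : Matrix (Fin n) (Fin n) ℂ,
        Tendsto (weylCentre U Y) (atTop ⊓ 𝓟 S.X) (𝓝 Cinf) ∧
        (⋂ t ∈ S.X ∩ Ici t₁, recentredWeylSimsSet U Y t) =
          (fun l => l - Cinf) '' S.limitWeylSimsSet U Y t₁ ∧
        Cinf ∈ S.limitWeylSimsSet U Y t₁) := by
  have hW := fun t ht => posSemidef_W (t := t) hadm hlam ht
  have hanti : ∀ t ∈ S.halfLine, ∀ τ ∈ S.halfLine, τ ≤ t →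
      weylSimsSet U Y t ⊆ weylSimsSet U Y τ := by
    intro t ht τ hτ hτt l hl
    rw [mem_weylSimsSet] at *
    exact (weylForm_mono hW hY hτ ht hτt l).trans hl
  refine ⟨fun t ht τ hτ h => hanti t ht τ hτ h.le, ?_, fun t₁ ht₁ hP => ?_⟩
  · obtain ⟨t₁, ht₁, hP⟩ := exists_posDef_weylP hW hY hdef
    exact ⟨t₁, ht₁, fun t ht => hP.of_le (weylP_mono hW hY ht₁ ⟨ht.1, (mem_Ici.1 ht₁.2).trans ht.2⟩ ht.2)⟩
  have hmem : ∀ t ∈ S.X ∩ Ici t₁, t ∈ S.halfLine := fun t ht => ⟨ht.1, (mem_Ici.1 ht₁.2).trans ht.2⟩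
  have hrec : ∀ t ∈ S.X ∩ Ici t₁, ∀ τ ∈ S.X ∩ Ici t₁, τ ≤ t →
      recentredWeylSimsSet U Y t ⊆ recentredWeylSimsSet U Y τ := fun t ht τ hτ h =>
    recentredWeylSimsSet_anti hW hY (hmem τ hτ) (hmem t ht) h (hP τ hτ)
  refine ⟨fun t ht τ hτ h => hrec t ht τ hτ h.le,
    fun t ht => ⟨isCompact_weylSimsSet (hP t ht), convex_weylSimsSet (hP t ht)⟩, ?_⟩
  obtain ⟨C, hC⟩ := exists_tendsto_weylCentre hW hY ht₁ hP
  have hne : (atTop ⊓ 𝓟 S.X).NeBot := by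
    rw [inf_principal_neBot_iff]
    intro V hV
    obtain ⟨b, hb⟩ := mem_atTop_sets.1 hV
    obtain ⟨x, hx, hbx⟩ := not_bddAbove_iff.1 S.not_bddAbove b
    exact ⟨x, hb x hbx.le, hx⟩
  have hev : ∀ τ ∈ S.X ∩ Ici t₁, ∀ᶠ t in atTop ⊓ 𝓟 S.X, t ∈ S.X ∩ Ici t₁ ∧ τ ≤ t := by
    intro τ hτ
    filter_upwards [mem_inf_of_left (Ici_mem_atTop τ), mem_inf_of_right (mem_principal_self S.X)]
      with t h1 h2
    exact ⟨⟨h2, (mem_Ici.1 hτ.2).trans h1⟩, h1⟩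
  refine ⟨C, hC, ?_, ?_⟩
  · ext m
    simp only [mem_iInter, mem_image, limitWeylSimsSet]
    constructor
    · intro h
      -- For `t ≥ τ` the point `m + 𝒞(t)` lies in `D(t) ⊆ D(τ)`; let `t → ∞` in the closed set
      -- `D(τ)`.
      refine ⟨m + C, fun τ hτ => ?_, add_sub_cancel_right _ _⟩
      refine isClosed_weylSimsSet.mem_of_tendsto (hC.const_add m) ?_
      filter_upwards [hev τ hτ] with t ht
      exact hanti t (hmem t ht.1) τ (hmem τ hτ) ht.2 (mem_recentredWeylSimsSet.1 (h t ht.1))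
    · rintro ⟨l, hl, rfl⟩ τ hτ
      rw [mem_recentredWeylSimsSet]
      -- Here the nesting of the recentred sets is used: `l - 𝒞(t)` lies in `D(τ) - 𝒞(τ)` for `t ≥
      -- τ`, and `t → ∞` replaces `𝒞(t)` by its limit.
      refine isClosed_weylSimsSet.mem_of_tendsto
        (f := fun t => l - weylCentre U Y t + weylCentre U Y τ)
        ((hC.const_sub l).add_const _) ?_
      filter_upwards [hev τ hτ] with t ht
      exact mem_recentredWeylSimsSet.1 (hrec t ht.1 τ hτ ht.2 ⟨l, hl t ht.1, rfl⟩)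
  · simp only [mem_iInter, limitWeylSimsSet]
    intro τ hτ
    refine isClosed_weylSimsSet.mem_of_tendsto hC ?_
    filter_upwards [hev τ hτ] with t ht
    exact hanti t (hmem t ht.1) τ (hmem τ hτ) ht.2
      (mem_weylSimsSet.2 (weylForm_weylCentre_nonpos (hP t ht.1)))

end
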